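/- Let $(\Omega,\mathcal F,\mathbb P)$ be a probability space and $\mathcal G\subseteq\mathcal F$ a sub-$\sigma$-algebra such that $(\Omega,\mathcal G,\mathbb P)$ is atomless, i.e. $\{\mathbb P(A): A\subseteq B,\ A\in\mathcal G\}=[0,\mathbb P(B)]$ for every $B\in\mathcal G$. Let $L^\infty$ be the space of essentially bounded real random variables on $(\Omega,\mathcal F,\mathbb P)$ (interpreted as losses; a.s. equal ones are identified), and $L^\infty(\mathcal G)$ the subspace of the $\mathcal G$-measurable ones. A coherent risk measure is a map $\rho:L^\infty\to\mathbb R$ such that, for all $X,Y\in L^\infty$: $\rho(X+c)=\rho(X)+c$ for $c\in\mathbb R$; $\rho(X)\le\rho(Y)$ if $X\le Y$ a.s.; $\rho(\lambda X+(1-\lambda)Y)\le\lambda\rho(X)+(1-\lambda)\rho(Y)$ for $\lambda\in[0,1]$; and $\rho(\lambda X)=\lambda\rho(X)$ for $\lambda\ge 0$. Let $\succsim$ be a preference relation on $L^\infty$ that is represented by some coherent risk measure $\rho$, i.e. $X\succsim Y\iff\rho(X)\le\rho(Y)$ for all $X,Y\in L^\infty$, and write $X\sim Y$ if $X\succsim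 Y$ and $Y\succsim X$. For $X,Y\in L^\infty$ write $Y\ge_1 X$ if $\mathbb P(Y\le x)\le\mathbb P(X\le x)$ for all $x\in\mathbb R$, and $Y\ge_2 X$ if $\mathbb E[\ell(Y)]\ge\mathbb E[\ell(X)]$ for all increasing (i.e. nondecreasing) convex functions $\ell:\mathbb R\to\mathbb R$. Then the following are equivalent: (i) ($\mathcal G$-law invariance) $X\sim Y$ for all $X,Y\in L^\infty(\mathcal G)$ with the same distribution under $\mathbb P$, i.e. $\mathbb P(X\le x)=\mathbb P(Y\le x)$ for all $x\in\mathbb R$; (ii) ($\mathcal G$-FSD monotonicity) $X\succsim Y$ for all $X,Y\in L^\infty(\mathcal G)$ with $Y\ge_1 X$; (iii) ($\mathcal G$-SSD monotonicity) $X\succsim Y$ for all $X,Y\in L^\infty(\mathcal G)$ with $Y\ge_2 X$. -/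

import Mathlib

open MeasureTheory
open scoped ENNReal

namespace PartialLaw

/-- The space `L^∞(Ω, ℱ, P)` of essentially bounded real random variables, up to a.s. equality.
An element represents a random loss. -/
abbrev Linf {Ω : Type*} [MeasurableSpace Ω] (P : Measure Ω) : Type _ := Lp ℝ ∞ P

/-- The constant random variable `c`. -/
noncomputable abbrev const {Ω : Type*} [MeasurableSpace Ω] (P : Measure Ω) [IsFiniteMeasure P]
    (c : ℝ) : Linf P := Lp.const ∞ P c

/-- `X ∈ L^∞(𝒢)`: the class `X` has a `𝒢`-measurable representative. -/
def IsMeas {Ω : Type*} (𝒢 : MeasurableSpace Ω) [MeasurableSpace Ω] {P : Measure Ω}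
    (X : Linf P) : Prop := AEStronglyMeasurable[𝒢] X P

/-- `(Ω, 𝒢, P)` is atomless: for every `B ∈ 𝒢`, the probabilities of the `𝒢`-measurable subsets
of `B` are exactly the numbers in `[0, P(B)]`. -/
def Atomless {Ω : Type*} (𝒢 : MeasurableSpace Ω) [MeasurableSpace Ω] (P : Measure Ω) : Prop :=
  ∀ B : Set Ω, MeasurableSet[𝒢] B →
    {r : ℝ | ∃ A : Set Ω, A ⊆ B ∧ MeasurableSet[𝒢] A ∧ P.real A = r} = Set.Icc 0 (P.real B)

/-- Equality in distribution under `P`. -/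
def EqInLaw {Ω : Type*} [MeasurableSpace Ω] {P : Measure Ω} (X Y : Linf P) : Prop :=
  ∀ x : ℝ, P {ω | X ω ≤ x} = P {ω | Y ω ≤ x}

/-- First-order stochastic dominance `X ≥₁ Y`. -/
def FSD {Ω : Type*} [MeasurableSpace Ω] {P : Measure Ω} (X Y : Linf P) : Prop :=
  ∀ x : ℝ, P {ω | X ω ≤ x} ≤ P {ω | Y ω ≤ x}

/-- Second-order stochastic dominance for losses, `X ≥₂ Y`: `E[ℓ(X)] ≥ E[ℓ(Y)]` for all
increasing convex `ℓ`. The integrals exist, as `ℓ` is continuous and `X`, `Y` are bounded. -/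
def SSD {Ω : Type*} [MeasurableSpace Ω] {P : Measure Ω} (X Y : Linf P) : Prop :=
  ∀ ℓ : ℝ → ℝ, Monotone ℓ → ConvexOn ℝ Set.univ ℓ → ∫ ω, ℓ (Y ω) ∂P ≤ ∫ ω, ℓ (X ω) ∂P

/-- Coherent risk measures on `L^∞`. The order on `L^∞` is a.s. inequality. -/
structure IsCoherent {Ω : Type*} [MeasurableSpace Ω] {P : Measure Ω} [IsFiniteMeasure P]
    (ρ : Linf P → ℝ) : Prop where
  cash_invariance : ∀ (X : Linf P) (c : ℝ), ρ (X + const P c) = ρ X + c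
  monotonicity : ∀ X Y : Linf P, X ≤ Y → ρ X ≤ ρ Y
  convexity : ∀ (X Y : Linf P) (t : ℝ), 0 ≤ t → t ≤ 1 →
    ρ (t • X + (1 - t) • Y) ≤ t * ρ X + (1 - t) * ρ Y
  positive_homogeneity : ∀ (X : Linf P) (t : ℝ), 0 ≤ t → ρ (t • X) = t * ρ X

/-- `pref X Y` means `X ≿ Y`. The relation is a CRM preference relation if it is represented by a
coherent risk measure: `X ≿ Y` iff `ρ X ≤ ρ Y` (smaller risk is preferred). -/
def IsCRM {Ω : Type*} [MeasurableSpace Ω] {P : Measure Ω} [IsFiniteMeasure P]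
    (pref : Linf P → Linf P → Prop) : Prop :=
  ∃ ρ : Linf P → ℝ, IsCoherent ρ ∧ ∀ X Y : Linf P, pref X Y ↔ ρ X ≤ ρ Y

/-- `𝒢`-law invariance: `X ∼ Y` for all `X, Y ∈ L^∞(𝒢)` with the same distribution. -/
def LawInvariant {Ω : Type*} (𝒢 : MeasurableSpace Ω) [MeasurableSpace Ω] {P : Measure Ω}
    (pref : Linf P → Linf P → Prop) : Prop :=
  ∀ X Y : Linf P, IsMeas 𝒢 X → IsMeas 𝒢 Y → EqInLaw X Y → pref X Y ∧ pref Y X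

/-- `𝒢`-FSD monotonicity: `X ≿ Y` for all `X, Y ∈ L^∞(𝒢)` with `Y ≥₁ X`. -/
def FSDMonotone {Ω : Type*} (𝒢 : MeasurableSpace Ω) [MeasurableSpace Ω] {P : Measure Ω}
    (pref : Linf P → Linf P → Prop) : Prop :=
  ∀ X Y : Linf P, IsMeas 𝒢 X → IsMeas 𝒢 Y → FSD Y X → pref X Y

/-- `𝒢`-SSD monotonicity: `X ≿ Y` for all `X, Y ∈ L^∞(𝒢)` with `Y ≥₂ X`. -/
def SSDMonotone {Ω : Type*} (𝒢 : MeasurableSpace Ω) [MeasurableSpace Ω] {P : Measure Ω}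
    (pref : Linf P → Linf P → Prop) : Prop :=
  ∀ X Y : Linf P, IsMeas 𝒢 X → IsMeas 𝒢 Y → SSD Y X → pref X Y

end PartialLaw

namespace PartialLaw

/-! Equal laws dominate each other in first order, and first-order dominance implies second-order
dominance, so the content is that law invariance yields monotonicity in `SSD`. On the atomless space
`(Ω, 𝒢, P.trim h𝒢)` the risk measure becomes a monotone, cash-additive, convex, law-invariant
functional `R` of bounded functions.

The engine is `merge_le`: averaging two values of a simple function does not raise `R`. Atomlessness
gives many rearrangements of the two cells, all with the same law, whose arithmetic mean is
uniformly close to the merged function. Convexity bounds `R` of the mean; monotonicity and cash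
additivity absorb the uniform error, so no continuity of `R` is assumed.

Convex combinations with the merged function give Robin Hood transfers (`transfer_le`), and finitely
many of these, with monotonicity, give the Hardy-Littlewood-Pólya comparison (`le_of_partial_sums`).
General functions are rounded to a grid and replaced by comonotone copies, for which the stop-loss
order becomes an inequality of partial sums. -/

/-- A bounded measurable real function. -/
def BddMeas {Ω : Type*} [MeasurableSpace Ω] (f : Ω → ℝ) : Prop :=
  Measurable f ∧ ∃ C : ℝ, ∀ ω, |f ω| ≤ C

/-- A monotone, cash-additive, convex and law-invariant functional on bounded measurable
functions. -/
structure LawInvariantConvex {Ω : Type*} [MeasurableSpace Ω] (P : Measure Ω)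
    (R : (Ω → ℝ) → ℝ) : Prop where
  mono : ∀ f g, BddMeas f → BddMeas g → (∀ᵐ ω ∂P, f ω ≤ g ω) → R f ≤ R g
  cash : ∀ f (c : ℝ), BddMeas f → R (fun ω => f ω + c) = R f + c
  convex : ConvexOn ℝ {f | BddMeas f} R
  law : ∀ f g, BddMeas f → BddMeas g → P.map f = P.map g → R f = R g

/-- Every measurable set has measurable subsets of all smaller measures. -/
def Divisible {Ω : Type*} [MeasurableSpace Ω] (P : Measure Ω) : Prop :=
  ∀ (B : Set Ω) (r : ℝ), MeasurableSet B → 0 ≤ r → r ≤ P.real B →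
    ∃ A : Set Ω, A ⊆ B ∧ MeasurableSet A ∧ P.real A = r

theorem BddMeas.comp_finite {Ω ι : Type*} [MeasurableSpace Ω] [Fintype ι] [MeasurableSpace ι]
    [MeasurableSingletonClass ι] {K : Ω → ι} (hK : Measurable K) (y : ι → ℝ) :
    BddMeas (fun ω => y (K ω)) := by
  refine ⟨(measurable_of_finite y).comp hK, ∑ i, |y i|, fun ω => ?_⟩
  exact Finset.single_le_sum (f := fun i => |y i|) (fun i _ => abs_nonneg _) (Finset.mem_univ (K ω))

/-! ### Equidistributed families of subsets -/

/-- In a set `B` of an atomless space there are `N` subsets of given measure whose overlap count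
varies by at most one over `B`. -/
theorem Divisible.exists_balanced {Ω : Type*} [MeasurableSpace Ω] {P : Measure Ω}
    [IsProbabilityMeasure P] (hP : Divisible P) {B : Set Ω} (hB : MeasurableSet B) {p : ℝ}
    (hp0 : 0 ≤ p) (hpB : p ≤ P.real B) (N : ℕ) :
    ∃ E : ℕ → Set Ω, (∀ k, E k ⊆ B ∧ MeasurableSet (E k) ∧ P.real (E k) = p) ∧
      ∃ m : ℝ, ∀ ω ∈ B, (∑ k ∈ Finset.range N, (E k).indicator (fun _ => (1 : ℝ)) ω) = m ∨
        (∑ k ∈ Finset.range N, (E k).indicator (fun _ => (1 : ℝ)) ω) = m + 1 := by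
  induction N with
  | zero =>
    obtain ⟨A, h1, h2, h3⟩ := hP B p hB hp0 hpB
    exact ⟨fun _ => A, fun _ => ⟨h1, h2, h3⟩, 0, fun ω _ => by simp⟩
  | succ N ih =>
    obtain ⟨E, hE, m, hm⟩ := ih
    set S : Ω → ℝ := fun ω => ∑ k ∈ Finset.range N, (E k).indicator (fun _ => (1 : ℝ)) ω with hS
    have hSm : Measurable S :=
      Finset.measurable_fun_sum _ fun k _ => measurable_const.indicator (hE k).2.1
    -- `L` is where the count is still low. The new set fills `L` before anything else: it lies
    -- inside `L` if `L` is large enough and contains `L` otherwise, so only two consecutive counts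
    -- occur.
    set L := B ∩ S ⁻¹' {m} with hL
    have hLm : MeasurableSet L := hB.inter (hSm (measurableSet_singleton m))
    have key : ∀ D : Set Ω, D ⊆ B → MeasurableSet D → P.real D = p → D ⊆ L ∨ L ⊆ D →
        ∃ E : ℕ → Set Ω, (∀ k, E k ⊆ B ∧ MeasurableSet (E k) ∧ P.real (E k) = p) ∧
        ∃ m : ℝ, ∀ ω ∈ B,
          (∑ k ∈ Finset.range (N + 1), (E k).indicator (fun _ => (1 : ℝ)) ω) = m ∨
          (∑ k ∈ Finset.range (N + 1), (E k).indicator (fun _ => (1 : ℝ)) ω) = m + 1 := by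
      intro D hDB hDm hDp hDL
      refine ⟨Function.update E N D, fun k => ?_, ?_⟩
      · rcases eq_or_ne k N with rfl | hk
        · simpa using ⟨hDB, hDm, hDp⟩
        · simpa [Function.update_of_ne hk] using hE k
      have hsum : ∀ ω, (∑ k ∈ Finset.range (N + 1),
          ((Function.update E N D) k).indicator (fun _ => (1 : ℝ)) ω) =
          S ω + D.indicator (fun _ => (1 : ℝ)) ω := by
        intro ω
        rw [Finset.sum_range_succ, Function.update_self]
        congr 1
        refine Finset.sum_congr rfl fun k hk => ?_
        rw [Function.update_of_ne (Finset.mem_range.1 hk).ne]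
      simp only [hsum]
      rcases hDL with h | h
      · refine ⟨m, fun ω hω => ?_⟩
        by_cases hD : ω ∈ D
        · have : S ω = m := (h hD).2
          simp [hD, this]
        · simpa [hD] using hm ω hω
      · refine ⟨m + 1, fun ω hω => ?_⟩
        by_cases hD : ω ∈ D
        · simpa [hD] using hm ω hω
        · have h1 : S ω ≠ m := fun h' => hD (h ⟨hω, h'⟩)
          simpa [hD, h1] using Or.inl ((hm ω hω).resolve_left h1)
    rcases le_total p (P.real L) with h | h
    · obtain ⟨D, h1, h2, h3⟩ := hP L p hLm hp0 h
      exact key D (h1.trans Set.inter_subset_left) h2 h3 (Or.inl h1)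
    · have hd : P.real (B \ L) = P.real B - P.real L :=
        measureReal_sdiff Set.inter_subset_left hLm
      obtain ⟨D, h1, h2, h3⟩ := hP (B \ L) (p - P.real L) (hB.diff hLm) (by linarith) (by linarith)
      refine key (L ∪ D) (Set.union_subset Set.inter_subset_left (h1.trans Set.sdiff_subset))
        (hLm.union h2) ?_ (Or.inr Set.subset_union_left)
      rw [measureReal_union (Set.disjoint_left.2 fun ω hω hD => (h1 hD).2 hω) h2, h3]
      ring

/-- The count takes only the values `m` and `m + 1` on `B`, so its mean over `B`, which is `N * (p /
P.real B)`, lies between them. -/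
theorem Divisible.exists_equidistributed {Ω : Type*} [MeasurableSpace Ω] {P : Measure Ω}
    [IsProbabilityMeasure P] (hP : Divisible P) {B : Set Ω} (hB : MeasurableSet B) {p : ℝ}
    (hp0 : 0 ≤ p) (hpB : p ≤ P.real B) (hB0 : 0 < P.real B) (N : ℕ) :
    ∃ E : ℕ → Set Ω, (∀ k, E k ⊆ B ∧ MeasurableSet (E k) ∧ P.real (E k) = p) ∧
      ∀ ω ∈ B, |(∑ k ∈ Finset.range N, (E k).indicator (fun _ => (1 : ℝ)) ω)
        - N * (p / P.real B)| ≤ 1 := by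
  obtain ⟨E, hE, m, hm⟩ := hP.exists_balanced hB hp0 hpB N
  refine ⟨E, hE, ?_⟩
  set S : Ω → ℝ := fun ω => ∑ k ∈ Finset.range N, (E k).indicator (fun _ => (1 : ℝ)) ω with hS
  have hi : ∀ k, IntegrableOn ((E k).indicator (fun _ => (1 : ℝ))) B P := fun k =>
    ((integrable_const (1 : ℝ)).indicator (hE k).2.1).integrableOn
  have hSi : IntegrableOn S B P := integrable_finsetSum _ fun k _ => hi k
  have hint : ∫ ω in B, S ω ∂P = N * p := by
    rw [hS, integral_finsetSum _ fun k _ => hi k]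
    rw [Finset.sum_congr rfl (g := fun _ => p)]
    · simp
    · intro k _
      rw [integral_indicator_const _ (hE k).2.1]
      simp [measureReal_restrict_apply (hE k).2.1, Set.inter_eq_left.2 (hE k).1, (hE k).2.2]
  have h1 : m * P.real B ≤ N * p := by
    rw [← hint]
    calc m * P.real B = ∫ ω in B, m ∂P := by simp [mul_comm]
      _ ≤ _ := setIntegral_mono_on (integrable_const _) hSi hB fun ω hω => by
        rcases hm ω hω with h | h <;> simp only [hS, h] <;> linarith
  have h2 : N * p ≤ (m + 1) * P.real B := by
    rw [← hint]
    calc _ ≤ ∫ ω in B, (m + 1) ∂P :=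
        setIntegral_mono_on hSi (integrable_const _) hB fun ω hω => by
          rcases hm ω hω with h | h <;> simp only [hS, h] <;> linarith
      _ = _ := by simp [mul_comm]
  intro ω hω
  rw [← le_div_iff₀ hB0] at h1
  rw [← div_le_iff₀ hB0] at h2
  rw [← mul_div_assoc, abs_le]
  rcases hm ω hω with h | h <;> rw [h] <;> constructor <;> linarith

/-! ### Averaging and mass transfers on finite partitions -/

/-- Replacing the values on two cells by their mean does not increase the risk. -/
theorem LawInvariantConvex.merge_le {Ω ι : Type*} [MeasurableSpace Ω] {P : Measure Ω}
    [IsProbabilityMeasure P] (hP : Divisible P) {R : (Ω → ℝ) → ℝ} (hR : LawInvariantConvex P R)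
    [Fintype ι] [DecidableEq ι] [MeasurableSpace ι] [MeasurableSingletonClass ι]
    {K : Ω → ι} (hK : Measurable K)
    (y : ι → ℝ) {i j : ι} (hij : i ≠ j) (hi : 0 < P.real (K ⁻¹' {i}))
    (hj : 0 < P.real (K ⁻¹' {j})) {z : ι → ℝ}
    (hzi : z i = (P.real (K ⁻¹' {i}) * y i + P.real (K ⁻¹' {j}) * y j) /
      (P.real (K ⁻¹' {i}) + P.real (K ⁻¹' {j})))
    (hzj : z j = z i) (hz : ∀ l, l ≠ i → l ≠ j → z l = y l) :
    R (fun ω => z (K ω)) ≤ R (fun ω => y (K ω)) := by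
  classical
  have hsing : ∀ l, MeasurableSet (K ⁻¹' {l}) := fun l => hK (measurableSet_singleton l)
  set B := K ⁻¹' {i} ∪ K ⁻¹' {j} with hBdef
  have hB : MeasurableSet B := (hsing i).union (hsing j)
  have hdisj : Disjoint (K ⁻¹' {i}) (K ⁻¹' {j}) :=
    Disjoint.preimage _ (by simpa using hij)
  have hBr : P.real B = P.real (K ⁻¹' {i}) + P.real (K ⁻¹' {j}) :=
    measureReal_union hdisj (hsing j)
  have hmemB : ∀ ω, ω ∈ B ↔ K ω = i ∨ K ω = j := fun ω => by simp [hBdef]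
  have main : ∀ N : ℕ, R (fun ω => z (K ω)) ≤
      R (fun ω => y (K ω)) + |y i - y j| * (1 / ((N : ℝ) + 1)) := by
    intro N
    obtain ⟨E, hE, hS⟩ := hP.exists_equidistributed hB hi.le (by linarith) (by linarith) (N + 1)
    -- `K' k` redistributes the labels inside `B`: `E k` becomes cell `i` and `B \ E k` becomes cell
    -- `j`. The masses are unchanged, hence so is the law.
    let K' : ℕ → Ω → ι := fun k ω => if ω ∈ B then (if ω ∈ E k then i else j) else K ω
    have hK'm : ∀ k, Measurable (K' k) := fun k =>
      Measurable.ite hB (Measurable.ite (hE k).2.1 measurable_const measurable_const) hK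
    have hlaw : ∀ k, P.map (K' k) = P.map K := by
      intro k
      refine Measure.ext_of_singleton fun l => ?_
      rw [Measure.map_apply (hK'm k) (measurableSet_singleton l),
        Measure.map_apply hK (measurableSet_singleton l)]
      by_cases hli : l = i
      · subst hli
        have : K' k ⁻¹' {l} = E k := by
          ext ω
          by_cases hω : ω ∈ B
          · by_cases hω' : ω ∈ E k <;> simp [K', hω, hω', hij.symm]
          · have h1 : ω ∉ E k := fun h => hω ((hE k).1 h)
            have h2 : K ω ≠ l := fun h => hω ((hmemB ω).2 (Or.inl h))
            simp [K', hω, h1, h2]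
        rw [this, ← measureReal_eq_measureReal_iff, (hE k).2.2]
      · by_cases hlj : l = j
        · subst hlj
          have : K' k ⁻¹' {l} = B \ E k := by
            ext ω
            by_cases hω : ω ∈ B
            · by_cases hω' : ω ∈ E k <;> simp [K', hω, hω', hij]
            · have h2 : K ω ≠ l := fun h => hω ((hmemB ω).2 (Or.inr h))
              simp [K', hω, h2]
          rw [this, ← measureReal_eq_measureReal_iff, measureReal_sdiff (hE k).1 (hE k).2.1,
            (hE k).2.2, hBr]
          ring
        · congr 1
          ext ω
          by_cases hω : ω ∈ B
          · have h2 : K ω ≠ l := fun h => by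
              rcases (hmemB ω).1 hω with h' | h'
              · exact hli (h.symm.trans h')
              · exact hlj (h.symm.trans h')
            by_cases hω' : ω ∈ E k <;> simp [K', hω, hω', h2, Ne.symm hli, Ne.symm hlj]
          · simp [K', hω]
    have hym : Measurable y := measurable_of_finite y
    have hmem : ∀ k ∈ Finset.range (N + 1), (fun ω => y (K' k ω)) ∈
        {f | f ∈ {f : Ω → ℝ | BddMeas f} ∧ R f ≤ R (fun ω => y (K ω))} := by
      intro k _
      refine ⟨BddMeas.comp_finite (hK'm k) y, le_of_eq ?_⟩
      refine hR.law _ _ (BddMeas.comp_finite (hK'm k) y) (BddMeas.comp_finite hK y) ?_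
      have := congrArg (Measure.map y) (hlaw k)
      rwa [Measure.map_map hym (hK'm k), Measure.map_map hym hK] at this
    have hN : (0 : ℝ) < (N : ℝ) + 1 := by positivity
    -- All rearranged copies lie in one sublevel set of `R`, which is convex, so their average `F`
    -- does too.
    have hF := (hR.convex.convex_le (R fun ω => y (K ω))).sum_mem
      (t := Finset.range (N + 1)) (w := fun _ => 1 / ((N : ℝ) + 1))
      (fun _ _ => by positivity) (by simp; field_simp) hmem
    set F := ∑ k ∈ Finset.range (N + 1), (1 / ((N : ℝ) + 1)) • (fun ω => y (K' k ω)) with hFdef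
    obtain ⟨hFb, hFR⟩ := hF
    have hFb' : BddMeas F := hFb
    have hFc : BddMeas (fun ω => F ω + |y i - y j| * (1 / ((N : ℝ) + 1))) := by
      obtain ⟨C, hC⟩ := hFb'.2
      refine ⟨hFb'.1.add_const _, C + |(|y i - y j| * (1 / ((N : ℝ) + 1)))|, fun ω => ?_⟩
      exact (abs_add_le _ _).trans (by linarith [hC ω])
    refine (hR.mono _ _ (BddMeas.comp_finite hK z) hFc (ae_of_all _ fun ω => ?_)).trans ?_
    · have hFω : F ω = (1 / ((N : ℝ) + 1)) * ∑ k ∈ Finset.range (N + 1), y (K' k ω) := by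
        simp [hFdef, Finset.mul_sum, Finset.sum_apply]
      by_cases hω : ω ∈ B
      · have h1 : ∀ k, y (K' k ω) = y j + (y i - y j) * (E k).indicator (fun _ => (1 : ℝ)) ω := by
          intro k
          by_cases hω' : ω ∈ E k <;> simp [K', hω, hω']
        have hzB : z (K ω) = y j + (y i - y j) * (P.real (K ⁻¹' {i}) / P.real B) := by
          have : z (K ω) = z i := by
            rcases (hmemB ω).1 hω with h | h <;> rw [h]
            exact hzj
          rw [this, hzi, hBr]
          field_simp
          ring
        have hS' := hS ω hω
        set S := ∑ k ∈ Finset.range (N + 1), (E k).indicator (fun _ => (1 : ℝ)) ω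
        rw [hFω, hzB]
        simp only [h1, Finset.sum_add_distrib, ← Finset.mul_sum]
        push_cast at hS'
        simp only [Finset.sum_const, Finset.card_range, nsmul_eq_mul]
        push_cast
        set q := P.real (K ⁻¹' {i}) / P.real B
        have h3 : (y i - y j) * (((N : ℝ) + 1) * q - S) ≤ |y i - y j| := by
          refine (le_abs_self _).trans ?_
          rw [abs_mul, abs_sub_comm (((N : ℝ) + 1) * q)]
          exact mul_le_of_le_one_right (abs_nonneg _) hS'
        have h4 : y j + (y i - y j) * q - 1 / ((N : ℝ) + 1) * (((N : ℝ) + 1) * y j +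
            (y i - y j) * S) = (y i - y j) * (((N : ℝ) + 1) * q - S) * (1 / ((N : ℝ) + 1)) := by
          field_simp
          ring
        have h5 := mul_le_mul_of_nonneg_right h3 (by positivity : 0 ≤ 1 / ((N : ℝ) + 1))
        linarith
      · have h1 : ∀ k, y (K' k ω) = y (K ω) := fun k => by simp [K', hω]
        have h2 : z (K ω) = y (K ω) := by
          rw [hmemB] at hω
          push Not at hω
          exact hz _ hω.1 hω.2
        have h3 : F ω = y (K ω) := by
          rw [hFω]
          simp only [h1, Finset.sum_const, Finset.card_range, nsmul_eq_mul]
          push_cast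
          field_simp
        rw [h2, h3]
        have : 0 ≤ |y i - y j| * (1 / ((N : ℝ) + 1)) := by positivity
        linarith
    · rw [hR.cash F _ hFb']
      linarith
  refine ge_of_tendsto' (x := Filter.atTop) ?_ main
  have := (tendsto_one_div_add_atTop_nhds_zero_nat (𝕜 := ℝ)).const_mul |y i - y j|
  simpa using this.const_add (R fun ω => y (K ω))

/-- Moving mass `δ` from a cell to another, keeping the order of the two values, does not increase
the risk. -/
theorem LawInvariantConvex.transfer_le {Ω ι : Type*} [MeasurableSpace Ω] {P : Measure Ω}
    [IsProbabilityMeasure P] (hP : Divisible P) {R : (Ω → ℝ) → ℝ} (hR : LawInvariantConvex P R)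
    [Fintype ι] [DecidableEq ι] [MeasurableSpace ι] [MeasurableSingletonClass ι]
    {K : Ω → ι} (hK : Measurable K)
    (y : ι → ℝ) {i j : ι} (hij : i ≠ j) (hi : 0 < P.real (K ⁻¹' {i}))
    (hj : 0 < P.real (K ⁻¹' {j})) {δ : ℝ} (hδ : 0 < δ) {y' : ι → ℝ}
    (hyi : y' i = y i - δ / P.real (K ⁻¹' {i})) (hyj : y' j = y j + δ / P.real (K ⁻¹' {j}))
    (hy : ∀ l, l ≠ i → l ≠ j → y' l = y l) (hle : y' j ≤ y' i) :
    R (fun ω => y' (K ω)) ≤ R (fun ω => y (K ω)) := by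
  set p := P.real (K ⁻¹' {i}) with hp
  set q := P.real (K ⁻¹' {j}) with hq
  let m := (p * y i + q * y j) / (p + q)
  let z : ι → ℝ := fun l => if l = i ∨ l = j then m else y l
  have hz : R (fun ω => z (K ω)) ≤ R (fun ω => y (K ω)) :=
    hR.merge_le hP hK y hij hi hj (by simp [z, m, hp, hq]) (by simp [z])
      (fun l h1 h2 => by simp [z, h1, h2])
  have hs : 0 < δ / p + δ / q := by positivity
  have hD : 0 < y i - y j := by linarith
  -- The transfer preserves the weighted mean of the two values and shrinks their gap by `δ / p + δ
  -- / q`; merging shrinks it to zero. So `y'` divides the segment from `y` to `z` in this ratio,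
  -- and `t ≤ 1` because the order of the values is kept.
  let t := (δ / p + δ / q) / (y i - y j)
  have ht0 : 0 ≤ t := by positivity
  have ht1 : t ≤ 1 := by
    rw [div_le_one hD]
    linarith
  have hconv := hR.convex.2 (x := fun ω => y (K ω)) (y := fun ω => z (K ω))
    (BddMeas.comp_finite hK y) (BddMeas.comp_finite hK z) (sub_nonneg.2 ht1) ht0
    (sub_add_cancel 1 t)
  have heq : (1 - t) • (fun ω => y (K ω)) + t • (fun ω => z (K ω)) = fun ω => y' (K ω) := by
    funext ω
    simp only [Pi.add_apply, Pi.smul_apply, smul_eq_mul]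
    generalize K ω = l
    by_cases h1 : l = i
    · subst h1
      simp only [hyi, z, true_or, if_true, m, t]
      field_simp
      ring
    · by_cases h2 : l = j
      · subst h2
        simp only [hyj, z, or_true, if_true, m, t]
        field_simp
        ring
      · simp only [hy l h1 h2, z, h1, h2, or_self, if_false]
        ring
  rw [heq] at hconv
  simp only [smul_eq_mul] at hconv
  nlinarith [mul_le_mul_of_nonneg_left hz ht0]

/-- The Hardy-Littlewood-Pólya comparison on finitely many cells. -/
theorem LawInvariantConvex.le_of_partial_sums {Ω ι : Type*} [MeasurableSpace Ω] {P : Measure Ω}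
    [IsProbabilityMeasure P] (hP : Divisible P) {R : (Ω → ℝ) → ℝ} (hR : LawInvariantConvex P R)
    [Fintype ι] [LinearOrder ι] [MeasurableSpace ι] [MeasurableSingletonClass ι]
    {K : Ω → ι} (hK : Measurable K) {x : ι → ℝ} (hx : Antitone x) (y : ι → ℝ)
    (hxy : ∀ k, ∑ l with l ≤ k, P.real (K ⁻¹' {l}) * x l ≤
      ∑ l with l ≤ k, P.real (K ⁻¹' {l}) * y l) :
    R (fun ω => x (K ω)) ≤ R (fun ω => y (K ω)) := by
  set p : ι → ℝ := fun l => P.real (K ⁻¹' {l}) with hp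
  have hp0 : ∀ l, 0 ≤ p l := fun l => measureReal_nonneg
  change ∀ k, ∑ l with l ≤ k, p l * x l ≤ ∑ l with l ≤ k, p l * y l at hxy
  -- Induction on the number of cells where `x` and `y` differ; weighting by `p` ignores null cells.
  obtain ⟨n, hn⟩ : ∃ n, (Finset.univ.filter fun l => p l * x l ≠ p l * y l).card ≤ n := ⟨_, le_rfl⟩
  induction n using Nat.strong_induction_on generalizing y with
  | _ n ih =>
  by_cases hex : ∃ j, p j * y j < p j * x j
  · obtain ⟨j, hj, hjmin⟩ := (wellFounded_lt (α := ι)).has_min {j | p j * y j < p j * x j} hex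
    have hlt : ∀ l, l < j → p l * x l ≤ p l * y l := fun l hl => not_lt.1 fun h => hjmin l h hl
    obtain ⟨i, hij, hi⟩ : ∃ i, i < j ∧ p i * x i < p i * y i := by
      by_contra! hcon
      refine absurd (hxy j) (not_le.2 (Finset.sum_lt_sum (fun l hl => ?_) ⟨j, by simp, hj⟩))
      rcases (Finset.mem_filter.1 hl).2.lt_or_eq with h | rfl
      · exact hcon l h
      · exact le_of_lt hj
    have hj' : p j * y j < p j * x j := hj
    have hpi : 0 < p i := (hp0 i).lt_of_ne fun h => by simp [← h] at hi
    have hpj : 0 < p j := (hp0 j).lt_of_ne fun h => by simp [← h] at hj'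
    -- The largest transfer that overshoots at neither cell. It settles at least one of them, and
    -- `y' j ≤ x j ≤ x i ≤ y' i` keeps the order.
    set δ := min (p i * y i - p i * x i) (p j * x j - p j * y j) with hδ
    have hδ0 : 0 < δ := lt_min (by linarith) (by linarith)
    have hδi : δ ≤ p i * y i - p i * x i := min_le_left _ _
    have hδj : δ ≤ p j * x j - p j * y j := min_le_right _ _
    let y' : ι → ℝ := fun l => if l = i then y i - δ / p i else if l = j then y j + δ / p j else y l
    have hyi : y' i = y i - δ / p i := by simp [y']
    have hyj : y' j = y j + δ / p j := by simp [y', hij.ne']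
    have hyl : ∀ l, l ≠ i → l ≠ j → y' l = y l := fun l h1 h2 => by simp [y', h1, h2]
    have hpyi : p i * y' i = p i * y i - δ := by rw [hyi]; field_simp
    have hpyj : p j * y' j = p j * y j + δ := by rw [hyj]; field_simp
    have hle : y' j ≤ y' i := by
      have h1 : x i ≤ y' i := le_of_mul_le_mul_left (by linarith) hpi
      have h2 : y' j ≤ x j := le_of_mul_le_mul_left (by linarith) hpj
      linarith [hx hij.le]
    refine le_trans ?_ (hR.transfer_le hP hK y hij.ne hpi hpj hδ0 hyi hyj hyl hle)
    refine ih (Finset.univ.filter fun l => p l * x l ≠ p l * y' l).card ?_ y' ?_ le_rfl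
    · refine lt_of_lt_of_le (Finset.card_lt_card ?_) hn
      refine Finset.ssubset_iff_subset_ne.2 ⟨fun l hl => ?_, fun heq => ?_⟩
      · simp only [Finset.mem_filter, Finset.mem_univ, true_and] at hl ⊢
        by_cases h1 : l = i
        · subst h1; exact hi.ne
        · by_cases h2 : l = j
          · subst h2; exact hj'.ne'
          · rwa [hyl l h1 h2] at hl
      · have hmi := (Finset.ext_iff.1 heq i).2 (by simpa using hi.ne)
        have hmj := (Finset.ext_iff.1 heq j).2 (by simpa using hj'.ne')
        simp only [Finset.mem_filter, Finset.mem_univ, true_and] at hmi hmj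
        rcases min_choice (p i * y i - p i * x i) (p j * x j - p j * y j) with h | h
        · exact hmi (by rw [hpyi]; linarith)
        · exact hmj (by rw [hpyj]; linarith)
    · intro k
      have hterm : ∀ l, p l * y' l = p l * y l + (if l = j then δ else 0) -
          (if l = i then δ else 0) := by
        intro l
        by_cases h1 : l = i
        · subst h1; simp [hpyi, hij.ne]
        · by_cases h2 : l = j
          · subst h2; simp [hpyj, h1]
          · simp [hyl l h1 h2, h1, h2]
      simp only [hterm, Finset.sum_sub_distrib, Finset.sum_add_distrib, Finset.sum_ite_eq',
        Finset.mem_filter, Finset.mem_univ, true_and]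
      by_cases hjk : j ≤ k
      · simpa [hjk, hij.le.trans hjk] using hxy k
      · by_cases hik : i ≤ k
        · simp only [hjk, hik, if_true, if_false]
          -- For `i ≤ k < j` the partial sum drops by `δ`. All terms before `j` have nonnegative
          -- surplus, so the surplus at `i` alone pays for it.
          have h1 := Finset.single_le_sum (s := Finset.univ.filter fun l => l ≤ k)
            (f := fun l => p l * y l - p l * x l) (fun l hl => sub_nonneg.2 (hlt l
              (lt_of_le_of_lt (Finset.mem_filter.1 hl).2 (not_le.1 hjk))))
            (Finset.mem_filter.2 ⟨Finset.mem_univ i, hik⟩)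
          rw [Finset.sum_sub_distrib] at h1
          linarith
        · simpa [hjk, hik] using hxy k
  · push Not at hex
    refine hR.mono _ _ (BddMeas.comp_finite hK x) (BddMeas.comp_finite hK y) ?_
    have h0 : ∀ᵐ ω ∂P, ∀ l, p l = 0 → K ω ≠ l := by
      refine ae_all_iff.2 fun l => ?_
      by_cases h : p l = 0
      · have h' : P (K ⁻¹' {l}) = 0 := (measureReal_eq_zero_iff).1 h
        filter_upwards [measure_eq_zero_iff_ae_notMem.1 h'] with ω hω _
        simpa using hω
      · exact ae_of_all _ fun ω h' => absurd h' h
    filter_upwards [h0] with ω hω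
    have : 0 < p (K ω) := (hp0 _).lt_of_ne fun h => hω _ h.symm rfl
    exact le_of_mul_le_mul_left (hex _) this

/-! ### Comonotone copies -/

/-- A chain of measurable sets with prescribed measures. -/
theorem Divisible.exists_chain {Ω : Type*} [MeasurableSpace Ω] {P : Measure Ω}
    [IsProbabilityMeasure P] (hP : Divisible P) (T : Finset ℝ) (hT : ∀ t ∈ T, 0 ≤ t ∧ t ≤ 1) :
    ∃ A : ℝ → Set Ω, (∀ t ∈ T, MeasurableSet (A t) ∧ P.real (A t) = t) ∧
      ∀ s ∈ T, ∀ t ∈ T, s ≤ t → A s ⊆ A t := by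
  classical
  induction T using Finset.induction_on_max with
  | empty => exact ⟨fun _ => ∅, by simp, by simp⟩
  | insert a T ha ih =>
    obtain ⟨A, hA, hmono⟩ := ih fun t ht => hT t (Finset.mem_insert_of_mem ht)
    obtain ⟨ha0, ha1⟩ := hT a (Finset.mem_insert_self _ _)
    obtain ⟨D, hDm, hD, hAD⟩ : ∃ D : Set Ω, MeasurableSet D ∧ P.real D = a ∧
        ∀ t ∈ T, A t ⊆ D := by
      rcases T.eq_empty_or_nonempty with rfl | hne
      · obtain ⟨D, -, h2, h3⟩ := hP Set.univ a .univ ha0 (by simpa using ha1)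
        exact ⟨D, h2, h3, by simp⟩
      · have hm := T.max'_mem hne
        set m := T.max' hne with hmdef
        have hc : P.real (A m)ᶜ = 1 - m := by
          rw [probReal_compl_eq_one_sub (hA m hm).1, (hA m hm).2]
        obtain ⟨D, h1, h2, h3⟩ := hP (A m)ᶜ (a - m) (hA m hm).1.compl
          (by linarith [ha m hm]) (by linarith)
        refine ⟨A m ∪ D, (hA m hm).1.union h2, ?_, fun t ht =>
          (hmono t ht m hm (T.le_max' t ht)).trans Set.subset_union_left⟩
        rw [measureReal_union (Set.disjoint_left.2 fun ω hω hD => h1 hD hω) h2, h3, (hA m hm).2]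
        ring
    refine ⟨Function.update A a D, fun t ht => ?_, fun s hs t ht hst => ?_⟩
    · rcases Finset.mem_insert.1 ht with rfl | ht'
      · simpa using ⟨hDm, hD⟩
      · simpa [Function.update_of_ne (ha t ht').ne] using hA t ht'
    · rcases Finset.mem_insert.1 ht with rfl | ht'
      · rcases Finset.mem_insert.1 hs with rfl | hs'
        · exact subset_rfl
        · simpa [Function.update_of_ne (ha s hs').ne] using hAD s hs'
      · rcases Finset.mem_insert.1 hs with rfl | hs'
        · exact absurd hst (not_le.2 (ha t ht'))
        · simpa [Function.update_of_ne (ha s hs').ne, Function.update_of_ne (ha t ht').ne] using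
            hmono s hs' t ht' hst

/-- A downward closed predicate selects an initial segment, so its cardinality decides membership.
-/
theorem lt_card_filter_range_iff {M : ℕ} {p : ℕ → Prop} [DecidablePred p]
    (hp : ∀ k l, k ≤ l → p l → p k) {k : ℕ} (hk : k < M) :
    k < ((Finset.range M).filter p).card ↔ p k := by
  constructor
  · intro h
    by_contra hpk
    have : (Finset.range M).filter p ⊆ Finset.range k := fun l hl => by
      rw [Finset.mem_range]
      by_contra hkl
      exact hpk (hp k l (not_lt.1 hkl) (Finset.mem_filter.1 hl).2)
    have := Finset.card_le_card this
    simp only [Finset.card_range] at this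
    omega
  · intro h
    have : Finset.range (k + 1) ⊆ (Finset.range M).filter p := fun l hl => by
      rw [Finset.mem_range] at hl
      exact Finset.mem_filter.2 ⟨Finset.mem_range.2 (by omega), hp l k (by omega) h⟩
    have := Finset.card_le_card this
    simp only [Finset.card_range] at this
    omega

theorem map_eq_of_measureReal_lt {Ω : Type*} [MeasurableSpace Ω] {P : Measure Ω}
    [IsProbabilityMeasure P] {a b : Ω → ℕ} (ha : Measurable a) (hb : Measurable b)
    (h : ∀ k, P.real {ω | k < a ω} = P.real {ω | k < b ω}) : P.map a = P.map b := by
  have := Measure.isProbabilityMeasure_map (μ := P) ha.aemeasurable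
  have := Measure.isProbabilityMeasure_map (μ := P) hb.aemeasurable
  refine Measure.ext_of_Iic _ _ fun k => ?_
  rw [Measure.map_apply ha measurableSet_Iic, Measure.map_apply hb measurableSet_Iic,
    ← measureReal_eq_measureReal_iff]
  have hc : ∀ c : Ω → ℕ, c ⁻¹' Set.Iic k = {ω | k < c ω}ᶜ := fun c => by ext; simp
  rw [hc, hc, probReal_compl_eq_one_sub (measurableSet_lt measurable_const ha),
    probReal_compl_eq_one_sub (measurableSet_lt measurable_const hb), h]

/-- Two bounded integer-valued random variables have a comonotone copy. -/
theorem Divisible.exists_comonotone {Ω : Type*} [MeasurableSpace Ω] {P : Measure Ω}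
    [IsProbabilityMeasure P] (hP : Divisible P) {a b : Ω → ℕ} (ha : Measurable a)
    (hb : Measurable b) {M : ℕ} (haM : ∀ ω, a ω ≤ M) (hbM : ∀ ω, b ω ≤ M) :
    ∃ (n : ℕ) (K : Ω → Fin n) (x y : Fin n → ℕ), Measurable K ∧ Antitone x ∧ Antitone y ∧
      P.map (fun ω => x (K ω)) = P.map a ∧ P.map (fun ω => y (K ω)) = P.map b := by
  classical
  let c : (Ω → ℕ) → ℕ → ℝ := fun a k => P.real {ω | k < a ω}
  have hc : ∀ a, Antitone (c a) := fun a k l hkl =>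
    measureReal_mono fun ω (hω : l < a ω) => lt_of_le_of_lt hkl hω
  -- The tail probabilities of both variables; one nested chain `A` of sets with these measures will
  -- serve as tail events for both copies.
  let T : Finset ℝ := (Finset.range M).image (c a) ∪ (Finset.range M).image (c b)
  obtain ⟨A, hA, hmono⟩ := hP.exists_chain T (by
    intro t ht
    rcases Finset.mem_union.1 ht with h | h <;> obtain ⟨k, -, rfl⟩ := Finset.mem_image.1 h <;>
      exact ⟨measureReal_nonneg, measureReal_le_one⟩)
  let r : ℝ → ℕ := fun t => (T.filter fun s => s ≤ t).card
  have hr : Monotone r := fun s t hst =>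
    Finset.card_le_card fun u hu => by
      rw [Finset.mem_filter] at hu ⊢
      exact ⟨hu.1, hu.2.trans hst⟩
  -- `K ω` counts the chain sets that miss `ω`. By nesting, `ω ∈ A t` exactly when this count is
  -- below the rank `r t`.
  let K : Ω → Fin (T.card + 1) := fun ω =>
    ⟨(T.filter fun s => ω ∉ A s).card, Nat.lt_succ_of_le (Finset.card_filter_le _ _)⟩
  have hKA : ∀ ω, ∀ t ∈ T, (K ω : ℕ) < r t ↔ ω ∈ A t := by
    intro ω t ht
    change (T.filter fun s => ω ∉ A s).card < (T.filter fun s => s ≤ t).card ↔ _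
    constructor
    · intro h
      by_contra hω
      refine absurd h (not_lt.2 (Finset.card_le_card fun s hs => ?_))
      rw [Finset.mem_filter] at hs ⊢
      exact ⟨hs.1, fun h' => hω (hmono s hs.1 t ht hs.2 h')⟩
    · intro hω
      refine Finset.card_lt_card (Finset.ssubset_iff_subset_ne.2 ⟨fun s hs => ?_, fun heq => ?_⟩)
      · rw [Finset.mem_filter] at hs ⊢
        refine ⟨hs.1, le_of_not_ge fun h => hs.2 (hmono t ht s hs.1 h hω)⟩
      · have := (Finset.ext_iff.1 heq t).2 (Finset.mem_filter.2 ⟨ht, le_rfl⟩)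
        exact (Finset.mem_filter.1 this).2 hω
  have hKm : Measurable K := by
    have h1 : Measurable fun ω => (T.filter fun s => ω ∉ A s).card := by
      simp only [Finset.card_filter]
      exact Finset.measurable_fun_sum _ fun t ht =>
        Measurable.ite (hA t ht).1.compl measurable_const measurable_const
    refine measurable_to_countable' fun i => ?_
    have : K ⁻¹' {i} = (fun ω => (T.filter fun s => ω ∉ A s).card) ⁻¹' {(i : ℕ)} := by
      ext ω
      simp [K, Fin.ext_iff]
    rw [this]
    exact h1 (measurableSet_singleton _)
  -- Chosen so that `{k < X a (K ω)}` is `A (c a k)` for `k < M`, which has the probability of `{k <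
  -- a ω}`.
  let X : (Ω → ℕ) → Fin (T.card + 1) → ℕ := fun a i =>
    ((Finset.range M).filter fun k => (i : ℕ) < r (c a k)).card
  have hX : ∀ a, Antitone (X a) := fun a i j hij => Finset.card_le_card fun k hk => by
    rw [Finset.mem_filter] at hk ⊢
    exact ⟨hk.1, lt_of_le_of_lt hij hk.2⟩
  have hmap : ∀ a : Ω → ℕ, Measurable a → (∀ ω, a ω ≤ M) → (∀ k < M, c a k ∈ T) →
      P.map (fun ω => X a (K ω)) = P.map a := by
    intro a ha haM hT
    refine map_eq_of_measureReal_lt ((measurable_of_finite (X a)).comp hKm) ha fun k => ?_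
    rcases lt_or_ge k M with hk | hk
    · have h1 : {ω | k < X a (K ω)} = A (c a k) := by
        ext ω
        rw [← hKA ω _ (hT k hk)]
        exact lt_card_filter_range_iff (fun k l hkl h => h.trans_le (hr (hc a hkl))) hk
      rw [h1, (hA _ (hT k hk)).2]
    · have h1 : ∀ ω, ¬ k < X a (K ω) := fun ω => not_lt.2
        (((Finset.card_filter_le _ _).trans (Finset.card_range M).le).trans hk)
      have h2 : ∀ ω, ¬ k < a ω := fun ω => not_lt.2 ((haM ω).trans hk)
      simp [h1, h2]
  exact ⟨_, K, X a, X b, hKm, hX a, hX b,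
    hmap a ha haM fun k hk => Finset.mem_union_left _
      (Finset.mem_image_of_mem _ (Finset.mem_range.2 hk)),
    hmap b hb hbM fun k hk => Finset.mem_union_right _
      (Finset.mem_image_of_mem _ (Finset.mem_range.2 hk))⟩

/-! ### From the stop-loss order to the functional -/

theorem integral_comp_finite {Ω ι : Type*} [MeasurableSpace Ω] {P : Measure Ω}
    [IsProbabilityMeasure P] [Fintype ι] [MeasurableSpace ι] [MeasurableSingletonClass ι]
    {K : Ω → ι} (hK : Measurable K) (h : ι → ℝ) :
    ∫ ω, h (K ω) ∂P = ∑ l, P.real (K ⁻¹' {l}) * h l := by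
  have := Measure.isProbabilityMeasure_map (μ := P) hK.aemeasurable
  rw [← integral_map (f := h) hK.aemeasurable (measurable_of_finite h).aestronglyMeasurable,
    integral_fintype (.of_finite)]
  refine Finset.sum_congr rfl fun l _ => ?_
  rw [map_measureReal_apply hK (measurableSet_singleton l), smul_eq_mul]

/-- Stop-loss order gives the comparison of partial sums over cells. -/
theorem partial_sums_le_of_stopLoss {ι : Type*} [Fintype ι] [LinearOrder ι] {p x y : ι → ℝ}
    (hp : ∀ l, 0 ≤ p l) (hy : Antitone y)
    (h : ∀ c : ℝ, ∑ l, p l * max (x l - c) 0 ≤ ∑ l, p l * max (y l - c) 0) (k : ι) :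
    ∑ l with l ≤ k, p l * x l ≤ ∑ l with l ≤ k, p l * y l := by
  -- Use the threshold `c = y k`: since `y` is antitone, its positive part is exactly the sum over
  -- `l ≤ k`, while for `x` the positive part only dominates that sum.
  have h1 : ∑ l with l ≤ k, p l * (x l - y k) ≤ ∑ l, p l * max (x l - y k) 0 := by
    rw [Finset.sum_filter]
    refine Finset.sum_le_sum fun l _ => ?_
    split_ifs
    · exact mul_le_mul_of_nonneg_left (le_max_left _ _) (hp l)
    · exact mul_nonneg (hp l) (le_max_right _ _)
  have h2 : ∑ l, p l * max (y l - y k) 0 = ∑ l with l ≤ k, p l * (y l - y k) := by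
    rw [Finset.sum_filter]
    refine Finset.sum_congr rfl fun l _ => ?_
    split_ifs with hl
    · rw [max_eq_left (sub_nonneg.2 (hy hl))]
    · rw [max_eq_right (sub_nonpos.2 (hy (not_le.1 hl).le)), mul_zero]
  have h3 := h1.trans ((h (y k)).trans h2.le)
  simp only [mul_sub, Finset.sum_sub_distrib] at h3
  linarith

theorem BddMeas.integrable {Ω : Type*} [MeasurableSpace Ω] {P : Measure Ω}
    [IsProbabilityMeasure P] {f : Ω → ℝ} (hf : BddMeas f) : Integrable f P := by
  obtain ⟨h, C, hC⟩ := hf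
  exact Integrable.of_bound h.aestronglyMeasurable C (ae_of_all _ hC)

theorem BddMeas.stopLoss {Ω : Type*} [MeasurableSpace Ω] {f : Ω → ℝ} (hf : BddMeas f) (c : ℝ) :
    BddMeas (fun ω => max (f ω - c) 0) := by
  obtain ⟨h, C, hC⟩ := hf
  refine ⟨(h.sub_const c).max measurable_const, C + |c|, fun ω => ?_⟩
  rw [abs_of_nonneg (le_max_right (f ω - c) 0)]
  refine max_le ?_ ?_
  · linarith [(abs_le.1 (hC ω)).2, neg_abs_le c]
  · linarith [hC ω, abs_nonneg c, abs_nonneg (f ω)]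

theorem BddMeas.add_const {Ω : Type*} [MeasurableSpace Ω] {f : Ω → ℝ} (hf : BddMeas f) (c : ℝ) :
    BddMeas (fun ω => f ω + c) := by
  obtain ⟨h, C, hC⟩ := hf
  exact ⟨h.add_const c, C + |c|, fun ω => (abs_add_le _ _).trans (by linarith [hC ω])⟩

/-- Law-invariant convex functionals on an atomless space respect the stop-loss order. -/
theorem LawInvariantConvex.le_of_stopLoss {Ω : Type*} [MeasurableSpace Ω] {P : Measure Ω}
    [IsProbabilityMeasure P] (hP : Divisible P) {R : (Ω → ℝ) → ℝ} (hR : LawInvariantConvex P R)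
    {f g : Ω → ℝ} (hf : BddMeas f) (hg : BddMeas g)
    (hfg : ∀ c : ℝ, ∫ ω, max (f ω - c) 0 ∂P ≤ ∫ ω, max (g ω - c) 0 ∂P) : R f ≤ R g := by
  refine le_of_forall_pos_le_add fun ε' hε' => ?_
  obtain ⟨ε, hε, hεε⟩ : ∃ ε : ℝ, 0 < ε ∧ ε + ε = ε' := ⟨ε' / 2, by positivity, by ring⟩
  obtain ⟨Cf, hCf⟩ := hf.2
  obtain ⟨Cg, hCg⟩ := hg.2
  obtain ⟨C, hC⟩ : ∃ C, C = max Cf Cg := ⟨_, rfl⟩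
  have hfC : ∀ ω, |f ω| ≤ C := fun ω => (hCf ω).trans (hC ▸ le_max_left _ _)
  have hgC : ∀ ω, |g ω| ≤ C := fun ω => (hCg ω).trans (hC ▸ le_max_right _ _)
  -- Rounding down to a grid of mesh `ε`; the shift by `C` makes the argument of the natural floor
  -- nonnegative, and `φ` undoes shift and scaling.
  let q : (Ω → ℝ) → Ω → ℕ := fun f ω => ⌊(f ω + C) / ε⌋₊
  have hqm : ∀ f, BddMeas f → Measurable (q f) := fun f hf =>
    ((hf.1.add_const C).div_const ε).nat_floor
  have hqM : ∀ f : Ω → ℝ, (∀ ω, |f ω| ≤ C) → ∀ ω, q f ω ≤ ⌊(C + C) / ε⌋₊ := fun f hfC ω =>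
    Nat.floor_le_floor (div_le_div_of_nonneg_right (by linarith [(abs_le.1 (hfC ω)).2]) hε.le)
  let φ : ℕ → ℝ := fun n => ε * n - C
  have hφ : Monotone φ := fun m n h => by
    have : (m : ℝ) ≤ n := by exact_mod_cast h
    have := mul_le_mul_of_nonneg_left this hε.le
    simp only [φ]
    linarith
  have hφm : Measurable φ := measurable_from_top
  have hlow : ∀ f : Ω → ℝ, (∀ ω, |f ω| ≤ C) → ∀ ω, φ (q f ω) ≤ f ω := fun f hfC ω => by
    have h0 : 0 ≤ (f ω + C) / ε := div_nonneg (by linarith [(abs_le.1 (hfC ω)).1]) hε.le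
    have := Nat.floor_le h0
    rw [le_div_iff₀ hε] at this
    simp only [φ, q]
    linarith
  have hupp : ∀ (f : Ω → ℝ) ω, f ω ≤ φ (q f ω) + ε := fun f ω => by
    have := (Nat.lt_floor_add_one ((f ω + C) / ε)).le
    rw [div_le_iff₀ hε] at this
    simp only [φ, q]
    linarith
  obtain ⟨n, K, x, y, hK, hx, hy, hxf, hyg⟩ :=
    hP.exists_comonotone (hqm f hf) (hqm g hg) (hqM f hfC) (hqM g hgC)
  have hbq : ∀ f, BddMeas f → (∀ ω, |f ω| ≤ C) → BddMeas (fun ω => φ (q f ω)) :=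
    fun f hf hfC => ⟨hφm.comp (hqm f hf), C + ε, fun ω => abs_le.2 ⟨by
      linarith [hupp f ω, (abs_le.1 (hfC ω)).1], by
      linarith [hlow f hfC ω, (abs_le.1 (hfC ω)).2]⟩⟩
  have hbx := BddMeas.comp_finite hK (fun i => φ (x i))
  have hby := BddMeas.comp_finite hK (fun i => φ (y i))
  have hmap : ∀ {f : Ω → ℝ} {x : Fin n → ℕ}, BddMeas f →
      P.map (fun ω => x (K ω)) = P.map (q f) → ∀ {h : ℕ → ℝ},
      P.map (fun ω => h (x (K ω))) = P.map (fun ω => h (q f ω)) := by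
    intro f x hf hxf h
    have hh : Measurable h := measurable_from_top
    have := congrArg (Measure.map h) hxf
    have hxK : Measurable fun ω => x (K ω) := (measurable_of_finite x).comp hK
    rwa [Measure.map_map hh hxK, Measure.map_map hh (hqm f hf)] at this
  have hint : ∀ {f : Ω → ℝ} {x : Fin n → ℕ}, BddMeas f →
      P.map (fun ω => x (K ω)) = P.map (q f) → ∀ h : ℕ → ℝ,
      ∫ ω, h (x (K ω)) ∂P = ∫ ω, h (q f ω) ∂P := by
    intro f x hf hxf h
    have hh : StronglyMeasurable h := measurable_from_top.stronglyMeasurable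
    have h1 := integral_map (μ := P) (φ := fun ω => x (K ω)) (f := h)
      ((measurable_of_finite x).comp hK).aemeasurable hh.aestronglyMeasurable
    have h2 := integral_map (μ := P) (φ := q f) (f := h)
      (hqm f hf).aemeasurable hh.aestronglyMeasurable
    rw [← h1, ← h2, hxf]
  -- Rounding lowers `g` by at most `ε`, so adding `ε` on that side preserves the stop-loss order.
  -- Restoring `f` in `e1` costs the second `ε`.
  have hxy : R (fun ω => φ (x (K ω))) ≤ R (fun ω => φ (y (K ω)) + ε) := by
    refine hR.le_of_partial_sums hP hK (x := fun i => φ (x i)) (hφ.comp_antitone hx)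
      (fun i => φ (y i) + ε) (partial_sums_le_of_stopLoss (fun _ => measureReal_nonneg)
        (fun i j hij => add_le_add_left (hφ (hy hij)) ε) fun c => ?_)
    rw [← integral_comp_finite hK (fun i => max (φ (x i) - c) 0),
      ← integral_comp_finite hK (fun i => max (φ (y i) + ε - c) 0),
      hint hf hxf (fun n => max (φ n - c) 0), hint hg hyg (fun n => max (φ n + ε - c) 0)]
    refine le_trans (integral_mono ((hbq f hf hfC).stopLoss c).integrable
      (hf.stopLoss c).integrable fun ω => ?_) ((hfg c).trans
      (integral_mono (hg.stopLoss c).integrable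
        (((hbq g hg hgC).add_const ε).stopLoss c).integrable fun ω => ?_))
    · exact max_le_max_right _ (sub_le_sub_right (hlow f hfC ω) c)
    · exact max_le_max_right _ (sub_le_sub_right (hupp g ω) c)
  have e1 : R f ≤ R (fun ω => φ (q f ω)) + ε := by
    rw [← hR.cash _ ε (hbq f hf hfC)]
    exact hR.mono _ _ hf ((hbq f hf hfC).add_const ε) (ae_of_all _ (hupp f))
  have e2 : R (fun ω => φ (q f ω)) = R (fun ω => φ (x (K ω))) :=
    (hR.law _ _ hbx (hbq f hf hfC) (hmap hf hxf)).symm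
  have e3 : R (fun ω => φ (y (K ω)) + ε) = R (fun ω => φ (q g ω)) + ε := by
    rw [hR.cash _ ε hby, hR.law _ _ hby (hbq g hg hgC) (hmap hg hyg)]
  have e4 : R (fun ω => φ (q g ω)) ≤ R g :=
    hR.mono _ _ (hbq g hg hgC) hg (ae_of_all _ (hlow g hgC))
  linarith

/-! ### First-order dominance implies second-order dominance -/

/-- An open upper set of reals is empty, the whole line or an open half-line, whose complement is a
distribution-function event. It serves for superlevel sets of increasing continuous functions. -/
theorem measure_preimage_le_of_isUpperSet {Ω : Type*} [MeasurableSpace Ω] {P : Measure Ω}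
    [IsProbabilityMeasure P] {f g : Ω → ℝ} (hf : Measurable f) (hg : Measurable g)
    (h : ∀ x, P {ω | g ω ≤ x} ≤ P {ω | f ω ≤ x}) {U : Set ℝ} (hU : IsOpen U)
    (hup : IsUpperSet U) : P (f ⁻¹' U) ≤ P (g ⁻¹' U) := by
  rcases U.eq_empty_or_nonempty with rfl | hne
  · simp
  by_cases hbdd : BddBelow U
  · have hUc : U = Set.Ioi (sInf U) := by
      ext x
      constructor
      · intro hx
        obtain ⟨y, hyx, hy⟩ := exists_Ioc_subset_of_mem_nhds (hU.mem_nhds hx) ⟨x - 1, by linarith⟩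
        have hm : (y + x) / 2 ∈ U := hy ⟨by linarith, by linarith⟩
        exact (csInf_le hbdd hm).trans_lt (by linarith)
      · intro hx
        obtain ⟨y, hy, hyx⟩ := exists_lt_of_csInf_lt hne hx
        exact hup hyx.le hy
    have hc : ∀ f : Ω → ℝ, f ⁻¹' U = {ω | f ω ≤ sInf U}ᶜ := fun f => by
      nth_rw 1 [hUc]
      ext
      simp
    rw [hc, hc, prob_compl_eq_one_sub (measurableSet_le hf measurable_const),
      prob_compl_eq_one_sub (measurableSet_le hg measurable_const)]
    exact tsub_le_tsub_left (h _) 1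
  · have : U = Set.univ := Set.eq_univ_of_forall fun x => by
      rw [not_bddBelow_iff] at hbdd
      obtain ⟨y, hy, hyx⟩ := hbdd x
      exact hup hyx.le hy
    simp [this]

/-- First-order dominance implies the comparison of expectations of increasing continuous
functions. -/
theorem integral_comp_le_of_cdf_le {Ω : Type*} [MeasurableSpace Ω] {P : Measure Ω}
    [IsProbabilityMeasure P] {f g : Ω → ℝ} (hf : Measurable f) (hg : Measurable g) {C : ℝ}
    (hfC : ∀ᵐ ω ∂P, |f ω| ≤ C) (hgC : ∀ᵐ ω ∂P, |g ω| ≤ C)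
    (h : ∀ x, P {ω | g ω ≤ x} ≤ P {ω | f ω ≤ x}) {φ : ℝ → ℝ} (hφ : Monotone φ)
    (hφc : Continuous φ) : ∫ ω, φ (f ω) ∂P ≤ ∫ ω, φ (g ω) ∂P := by
  have hint : ∀ f : Ω → ℝ, Measurable f → (∀ᵐ ω ∂P, |f ω| ≤ C) →
      Integrable (fun ω => φ (f ω)) P := fun f hf hfC => by
    refine Integrable.of_bound (hφc.measurable.comp hf).aestronglyMeasurable
      (max |φ (-C)| |φ C|) ?_
    filter_upwards [hfC] with ω hω
    exact abs_le_max_abs_abs (hφ (abs_le.1 hω).1) (hφ (abs_le.1 hω).2)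
  have hnn : ∀ f : Ω → ℝ, (∀ᵐ ω ∂P, |f ω| ≤ C) → 0 ≤ᵐ[P] fun ω => φ (f ω) - φ (-C) :=
    fun f hfC => by
      filter_upwards [hfC] with ω hω
      exact sub_nonneg.2 (hφ (abs_le.1 hω).1)
  have hm : ∀ f : Ω → ℝ, Measurable f → Measurable fun ω => φ (f ω) - φ (-C) :=
    fun f hf => (hφc.measurable.comp hf).sub_const _
  -- Subtracting `φ (-C)` makes the integrands nonnegative a.e., so the layer-cake formula reduces
  -- the claim to superlevel sets.
  have key : ∫ ω, (φ (f ω) - φ (-C)) ∂P ≤ ∫ ω, (φ (g ω) - φ (-C)) ∂P := by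
    rw [integral_eq_lintegral_of_nonneg_ae (hnn f hfC) (hm f hf).aestronglyMeasurable,
      integral_eq_lintegral_of_nonneg_ae (hnn g hgC) (hm g hg).aestronglyMeasurable]
    refine ENNReal.toReal_mono ?_ ?_
    · exact (((hint g hg hgC).sub (integrable_const _)).lintegral_lt_top).ne
    · rw [lintegral_eq_lintegral_meas_lt P (hnn f hfC) (hm f hf).aemeasurable,
        lintegral_eq_lintegral_meas_lt P (hnn g hgC) (hm g hg).aemeasurable]
      refine lintegral_mono fun t => ?_
      exact measure_preimage_le_of_isUpperSet hf hg h (U := {x | t < φ x - φ (-C)})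
        (isOpen_lt continuous_const (hφc.sub continuous_const))
        (fun x y hxy (hx : t < φ x - φ (-C)) => show t < φ y - φ (-C) by linarith [hφ hxy])
  rw [integral_sub (hint f hf hfC) (integrable_const _),
    integral_sub (hint g hg hgC) (integrable_const _)] at key
  linarith

theorem Linf.ae_abs_le {Ω : Type*} [MeasurableSpace Ω] {P : Measure Ω} (X : Linf P) :
    ∃ C : ℝ, ∀ᵐ ω ∂P, |X ω| ≤ C := by
  refine ⟨(eLpNormEssSup X P).toReal, ?_⟩
  have hfin : eLpNormEssSup X P ≠ ∞ := by
    rw [← eLpNorm_exponent_top]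
    exact (Lp.memLp X).eLpNorm_ne_top
  filter_upwards [ae_le_eLpNormEssSup (f := X) (μ := P)] with ω hω
  rw [← Real.norm_eq_abs, ← toReal_enorm]
  exact ENNReal.toReal_mono hfin hω

/-- A finite convex function on the line is continuous, so the comparison for continuous increasing
functions applies. -/
theorem FSD.ssd {Ω : Type*} [MeasurableSpace Ω] {P : Measure Ω} [IsProbabilityMeasure P]
    {X Y : Linf P} (h : FSD Y X) : SSD Y X := by
  intro φ hφ hconv
  obtain ⟨C, hC⟩ := Linf.ae_abs_le X
  obtain ⟨D, hD⟩ := Linf.ae_abs_le Y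
  refine integral_comp_le_of_cdf_le (C := max C D) (Lp.stronglyMeasurable X).measurable
    (Lp.stronglyMeasurable Y).measurable ?_ ?_ h hφ ?_
  · filter_upwards [hC] with ω hω using hω.trans (le_max_left _ _)
  · filter_upwards [hD] with ω hω using hω.trans (le_max_right _ _)
  · exact continuousOn_univ.1 (hconv.continuousOn isOpen_univ)

/-! ### Passage between `L^∞(𝒢)` and bounded `𝒢`-measurable functions -/

theorem Atomless.divisible {Ω : Type*} {𝒢 : MeasurableSpace Ω} [ℱ : MeasurableSpace Ω]
    {P : Measure Ω} (h𝒢 : 𝒢 ≤ ℱ) (hP : Atomless 𝒢 P) : @Divisible Ω 𝒢 (P.trim h𝒢) := by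
  have htrim : ∀ B, MeasurableSet[𝒢] B → (P.trim h𝒢).real B = P.real B := fun B hB => by
    simp only [measureReal_def, trim_measurableSet_eq h𝒢 hB]
  intro B r hB h0 hr
  rw [htrim B hB] at hr
  have hmem : r ∈ Set.Icc 0 (P.real B) := ⟨h0, hr⟩
  rw [← hP B hB] at hmem
  obtain ⟨A, hAB, hA, rfl⟩ := hmem
  exact ⟨A, hAB, hA, htrim A hA⟩

theorem BddMeas.memLp {Ω : Type*} {𝒢 : MeasurableSpace Ω} [ℱ : MeasurableSpace Ω]
    (P : Measure Ω) (h𝒢 : 𝒢 ≤ ℱ) {f : Ω → ℝ} (hf : @BddMeas Ω 𝒢 f) : MemLp f ∞ P := by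
  obtain ⟨h, C, hC⟩ := hf
  exact memLp_top_of_bound (h.mono h𝒢 le_rfl).aestronglyMeasurable C (ae_of_all _ hC)

/-- Every element of `L^∞(𝒢)` has a bounded `𝒢`-measurable representative. -/
theorem IsMeas.exists_bddMeas {Ω : Type*} {𝒢 : MeasurableSpace Ω} [ℱ : MeasurableSpace Ω]
    {P : Measure Ω} {X : Linf P} (hX : IsMeas 𝒢 X) :
    ∃ f : Ω → ℝ, @BddMeas Ω 𝒢 f ∧ X =ᵐ[P] f := by
  obtain ⟨g, hg, hXg⟩ := hX
  obtain ⟨C, hC⟩ := Linf.ae_abs_le X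
  refine ⟨fun ω => max (-C) (min C (g ω)),
    ⟨measurable_const.max (measurable_const.min hg.measurable), |C|, fun ω => ?_⟩, ?_⟩
  · refine abs_le.2 ⟨(neg_le_neg (le_abs_self C)).trans (le_max_left _ _), ?_⟩
    exact max_le (neg_le_abs C) ((min_le_left _ _).trans (le_abs_self C))
  · filter_upwards [hXg, hC] with ω h1 h2
    rw [h1, abs_le] at h2
    rw [h1, min_eq_right h2.2, max_eq_right h2.1]

open Classical in
/-- A functional on `L^∞` seen as a functional on functions. -/
noncomputable def onFun {Ω : Type*} [MeasurableSpace Ω] {P : Measure Ω} (ρ : Linf P → ℝ)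
    (f : Ω → ℝ) : ℝ :=
  -- The default value plays no role: bounded `𝒢`-measurable functions are all in `L^∞`.
  if h : MemLp f ∞ P then ρ h.toLp else 0

theorem onFun_of_memLp {Ω : Type*} [MeasurableSpace Ω] {P : Measure Ω} (ρ : Linf P → ℝ)
    {f : Ω → ℝ} (h : MemLp f ∞ P) : onFun ρ f = ρ h.toLp := dif_pos h

theorem onFun_of_ae_eq {Ω : Type*} [MeasurableSpace Ω] {P : Measure Ω} (ρ : Linf P → ℝ)
    {f : Ω → ℝ} {X : Linf P} (h : X =ᵐ[P] f) : onFun ρ f = ρ X := by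
  have hf : MemLp f ∞ P := (Lp.memLp X).ae_eq h
  rw [onFun_of_memLp ρ hf]
  congr 1
  exact Lp.ext (hf.coeFn_toLp.trans h.symm)

theorem IsCoherent.lawInvariantConvex {Ω : Type*} {𝒢 : MeasurableSpace Ω}
    [ℱ : MeasurableSpace Ω] {P : Measure Ω} [IsProbabilityMeasure P] (h𝒢 : 𝒢 ≤ ℱ)
    {ρ : Linf P → ℝ} (hρ : IsCoherent ρ)
    (hlaw : ∀ X Y : Linf P, IsMeas 𝒢 X → IsMeas 𝒢 Y → EqInLaw X Y → ρ X = ρ Y) :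
    @LawInvariantConvex Ω 𝒢 (P.trim h𝒢) (onFun ρ) := by
  have hL : ∀ {f : Ω → ℝ}, @BddMeas Ω 𝒢 f → MemLp f ∞ P := fun hf => hf.memLp P h𝒢
  refine @LawInvariantConvex.mk Ω 𝒢 _ _ ?_ ?_ ⟨?_, ?_⟩ ?_
  · intro f g hf hg hfg
    rw [onFun_of_memLp ρ (hL hf), onFun_of_memLp ρ (hL hg)]
    refine hρ.monotonicity _ _ ((Lp.coeFn_le _ _).1 ?_)
    filter_upwards [ae_of_ae_trim h𝒢 hfg, (hL hf).coeFn_toLp, (hL hg).coeFn_toLp] with ω h1 h2 h3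
    rwa [h2, h3]
  · intro f c hf
    rw [onFun_of_memLp ρ (hL hf), ← hρ.cash_invariance]
    refine onFun_of_ae_eq ρ ?_
    filter_upwards [(hL hf).coeFn_toLp, Lp.coeFn_add (hL hf).toLp (const P c),
      Lp.coeFn_const ∞ P c] with ω h1 h2 h3
    rw [h2, Pi.add_apply, h1, h3, Function.const_apply]
  · rintro f ⟨hf, C, hC⟩ g ⟨hg, D, hD⟩ a b ha hb -
    refine ⟨(hf.const_mul a).add (hg.const_mul b), a * C + b * D, fun ω => ?_⟩
    refine (abs_add_le _ _).trans (add_le_add ?_ ?_) <;> simp only [Pi.smul_apply, smul_eq_mul]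
    · rw [abs_mul, abs_of_nonneg ha]
      exact mul_le_mul_of_nonneg_left (hC ω) ha
    · rw [abs_mul, abs_of_nonneg hb]
      exact mul_le_mul_of_nonneg_left (hD ω) hb
  · intro f hf g hg a b ha hb hab
    rw [onFun_of_memLp ρ (hL hf), onFun_of_memLp ρ (hL hg)]
    obtain rfl : b = 1 - a := by linarith
    refine le_trans (le_of_eq ?_) (hρ.convexity (hL hf).toLp (hL hg).toLp a ha (by linarith))
    refine onFun_of_ae_eq ρ ?_
    filter_upwards [(hL hf).coeFn_toLp, (hL hg).coeFn_toLp,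
      Lp.coeFn_add (a • (hL hf).toLp) ((1 - a) • (hL hg).toLp),
      Lp.coeFn_smul a (hL hf).toLp, Lp.coeFn_smul (1 - a) (hL hg).toLp] with ω h1 h2 h3 h4 h5
    rw [h3, Pi.add_apply, h4, h5, Pi.smul_apply, Pi.smul_apply, h1, h2]
    rfl
  · intro f g hf hg hfg
    rw [onFun_of_memLp ρ (hL hf), onFun_of_memLp ρ (hL hg)]
    have hmeas : ∀ {f : Ω → ℝ} (hf : @BddMeas Ω 𝒢 f), IsMeas 𝒢 (hL hf).toLp := fun {f} hf =>
      ⟨f, hf.1.stronglyMeasurable, (hL hf).coeFn_toLp⟩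
    refine hlaw _ _ (hmeas hf) (hmeas hg) fun x => ?_
    -- `{f ≤ x}` belongs to `𝒢`, so its trimmed measure is its `P`-measure and equal image measures
    -- give `EqInLaw`.
    have hcdf : ∀ {f : Ω → ℝ} (hf : @BddMeas Ω 𝒢 f),
        P {ω | ((hL hf).toLp : Linf P) ω ≤ x} = (@Measure.map Ω ℝ 𝒢 _ f (P.trim h𝒢)) (Set.Iic x) :=
      fun {f} hf => by
        rw [@Measure.map_apply Ω ℝ 𝒢 _ _ _ hf.1 _ measurableSet_Iic,
          trim_measurableSet_eq h𝒢 (hf.1 measurableSet_Iic)]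
        refine measure_congr ?_
        filter_upwards [(hL hf).coeFn_toLp] with ω h1
        change (((hL hf).toLp : Linf P) ω ≤ x) = (f ω ≤ x)
        rw [h1]
    rw [hcdf hf, hcdf hg, hfg]

/-- A coherent risk measure which is law-invariant on `L^∞(𝒢)` is monotone on `L^∞(𝒢)` in
second-order stochastic dominance. -/
theorem IsCoherent.le_of_ssd {Ω : Type*} {𝒢 : MeasurableSpace Ω}
    [ℱ : MeasurableSpace Ω] {P : Measure Ω} [IsProbabilityMeasure P] (h𝒢 : 𝒢 ≤ ℱ)
    (hP : Atomless 𝒢 P) {ρ : Linf P → ℝ} (hρ : IsCoherent ρ)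
    (hlaw : ∀ X Y : Linf P, IsMeas 𝒢 X → IsMeas 𝒢 Y → EqInLaw X Y → ρ X = ρ Y)
    {X Y : Linf P} (hX : IsMeas 𝒢 X) (hY : IsMeas 𝒢 Y) (hXY : SSD Y X) : ρ X ≤ ρ Y := by
  obtain ⟨f, hf, hXf⟩ := hX.exists_bddMeas
  obtain ⟨g, hg, hYg⟩ := hY.exists_bddMeas
  rw [← onFun_of_ae_eq ρ hXf, ← onFun_of_ae_eq ρ hYg]
  have hprob : @IsProbabilityMeasure Ω 𝒢 (P.trim h𝒢) :=
    @IsProbabilityMeasure.mk Ω 𝒢 _ (by rw [trim_measurableSet_eq h𝒢 .univ, measure_univ])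
  refine @LawInvariantConvex.le_of_stopLoss Ω 𝒢 (P.trim h𝒢) hprob (hP.divisible h𝒢) (onFun ρ)
    (hρ.lawInvariantConvex h𝒢 hlaw) f g hf hg fun c => ?_
  have hint : ∀ {f : Ω → ℝ} {X : Linf P}, @BddMeas Ω 𝒢 f → X =ᵐ[P] f →
      ∫ ω, max (f ω - c) 0 ∂(P.trim h𝒢) = ∫ ω, max (X ω - c) 0 ∂P := by
    intro f X hf hXf
    rw [← integral_trim h𝒢 (@BddMeas.stopLoss Ω 𝒢 f hf c).1.stronglyMeasurable]
    refine integral_congr_ae ?_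
    filter_upwards [hXf] with ω hω
    rw [hω]
  rw [hint hf hXf, hint hg hYg]
  -- Stop-loss functions are the only increasing convex test functions needed.
  refine hXY (fun x => max (x - c) 0) ?_ ?_
  · intro x y hxy
    exact max_le_max_right _ (sub_le_sub_right hxy c)
  · exact ((convexOn_id convex_univ).sub (concaveOn_const c convex_univ)).sup
      (convexOn_const 0 convex_univ)

end PartialLaw

theorem mainTheorem10 {Ω : Type*} (𝒢 : MeasurableSpace Ω) [ℱ : MeasurableSpace Ω]
    (P : Measure Ω) [IsProbabilityMeasure P] (h𝒢 : 𝒢 ≤ ℱ) (hP : PartialLaw.Atomless 𝒢 P)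
    (pref : PartialLaw.Linf P → PartialLaw.Linf P → Prop) (hpref : PartialLaw.IsCRM pref) :
    [PartialLaw.LawInvariant 𝒢 pref, PartialLaw.FSDMonotone 𝒢 pref,
      PartialLaw.SSDMonotone 𝒢 pref].TFAE := by
  obtain ⟨ρ, hρ, hrep⟩ := hpref
  tfae_have 1 → 3 := by
    intro h X Y hX hY hXY
    refine (hrep X Y).2 (hρ.le_of_ssd h𝒢 hP (fun X Y hX hY hXY => ?_) hX hY hXY)
    exact le_antisymm ((hrep X Y).1 (h X Y hX hY hXY).1) ((hrep Y X).1 (h X Y hX hY hXY).2)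
  tfae_have 3 → 2 := fun h X Y hX hY hXY => h X Y hX hY hXY.ssd
  tfae_have 2 → 1 := fun h X Y hX hY hXY =>
    ⟨h X Y hX hY fun x => (hXY x).ge, h Y X hY hX fun x => (hXY x).le⟩
  tfae_finish
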